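/- Let $\mathbb X,\mathbb Y,\mathbb E$ be finite-dimensional Euclidean spaces, $\Phi:\mathbb X\to\mathbb E$ and $K:\mathbb X\to\mathbb Y$ linear operators, and $g:\mathbb Y\to\mathbb R\cup\{\infty\}$ a proper lower semicontinuous convex function with Fenchel conjugate $g^*$. Let $S_{LS}$ be either the optimal solution mapping $$S_{LS}(b,\mu)=\operatorname{argmin}_{x\in\mathbb X}\Big\{\tfrac1{2\mu}\|\Phi x-b\|^2+g(Kx)\Big\}$$ or the solution mapping of the optimality system $$S_{LS}(b,\mu)=\Big\{x\in\mathbb X \,\Big|\, 0\in\tfrac1\mu\Phi^*(\Phi x-b)+K^*\partial g(Kx)\Big\},\qquad b\in\mathbb E,\ \mu>0;$$ the result holds for each of the two. Let $\bar b\in\mathbb E$, $\bar\mu>0$, $\bar x\in S_{LS}(\bar b,\bar\mu)$ and $\bar y\in\partial g(K\bar x)$ with $K^*\bar y=-\frac1{\bar\mu}\Phi^*(\Phi\bar x-\bar b)$. $S_{LS}$ is called isolated calm at $(\bar b,\bar\mu)$ for $\bar x$ if there are $\kappa>0$ and neighborhoods $U$ of $\bar x$, $V$ of $\bar b$ and $W$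 of $\bar\mu$ in $(0,\infty)$ with $\|x-\bar x\|\le\kappa(\|b-\bar b\|+|\mu-\bar\mu|)$ whenever $b\in V$, $\mu\in W$ and $x\in S_{LS}(b,\mu)\cap U$. The function $g$ satisfies the quadratic growth condition at $K\bar x$ for $\bar y$ if there are $c,\varepsilon>0$ with $$g(z)\ge g(K\bar x)+\langle\bar y,z-K\bar x\rangle+\tfrac c2\,d\big(z;(\partial g)^{-1}(\bar y)\big)^2\quad\text{whenever } \|z-K\bar x\|<\varepsilon.$$ $T_\Omega(\bar z)=\{w\mid \exists\, t_k\downarrow0,\ w_k\to w,\ \bar z+t_kw_k\in\Omega\}$ denotes the tangent (contingent) cone to $\Omega$ at $\bar z$. 1. If $S_{LS}$ is isolated calm at $(\bar b,\bar\mu)$ for $\bar x$, then $\operatorname{Ker}\Phi\cap K^{-1}\big(T_{\partial g^*(\bar y)\cap\operatorname{Im}K}(K\bar x)\big)=\{0\}$. 2. If $g$ satisfies the quadratic growth condition at $K\bar x$ for $\bar y$ and $$\operatorname{Ker}\Phi\cap K^{-1}\big(T_{\partial g^*(\bar y)}(K\bar x)\big)=\{0\},\tag{$*$}$$ then $S_{LS}$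 is isolated calm at $(\bar b,\bar\mu)$ for $\bar x$. 3. Consequently, if $g$ satisfies the quadratic growth condition at $K\bar x$ for $\bar y$, then $(*)$ is necessary and sufficient for the isolated calmness of $S_{LS}$ at $(\bar b,\bar\mu)$ for $\bar x$, provided that one of the following holds: (i) $\partial g^*(\bar y)$ is polyhedral, i.e. an intersection of finitely many closed half-spaces; (ii) $\operatorname{Im}K\cap\operatorname{ri}\partial g^*(\bar y)\ne\emptyset$, where $\operatorname{ri}$ is the relative interior. -/

import Mathlib

open Set Filter Topology

section ConvexAnalysis

/-- `φ : X → ℝ ∪ {+∞}` (an `EReal`-valued function that never takes the value `-∞`) is proper,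
lower semicontinuous and convex. Convexity is convexity of the epigraph in `X × ℝ`. -/
structure ProperLscConvex {X : Type*} [NormedAddCommGroup X] [InnerProductSpace ℝ X]
    (φ : X → EReal) : Prop where
  ne_bot : ∀ x, φ x ≠ ⊥
  exists_ne_top : ∃ x, φ x ≠ ⊤
  lsc : LowerSemicontinuous φ
  convex : Convex ℝ {p : X × ℝ | φ p.1 ≤ (p.2 : EReal)}

/-- The convex subdifferential `∂φ(x) = {v | φ(u) ≥ φ(x) + ⟪v, u - x⟫ for all u}`.
For a proper `φ` it is empty at the points where `φ x = +∞`. -/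
def subdiff {X : Type*} [NormedAddCommGroup X] [InnerProductSpace ℝ X]
    (φ : X → EReal) (x : X) : Set X :=
  {v | ∀ u, φ x + ((inner ℝ v (u - x) : ℝ) : EReal) ≤ φ u}

/-- The Fenchel conjugate `φ*(v) = sup_x (⟪v, x⟫ - φ(x))`. -/
noncomputable def fenchelConj {X : Type*} [NormedAddCommGroup X] [InnerProductSpace ℝ X]
    (φ : X → EReal) (v : X) : EReal :=
  ⨆ x, ((inner ℝ v x : ℝ) : EReal) - φ x

/-- The quadratic growth condition of `φ` at `x₀` for `v`: there are `c, ε > 0` with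
`φ(x) ≥ φ(x₀) + ⟪v, x - x₀⟫ + (c/2) d(x; (∂φ)⁻¹(v))²` for all `x` in the open ball
of radius `ε` around `x₀`. -/
def QuadraticGrowth {X : Type*} [NormedAddCommGroup X] [InnerProductSpace ℝ X]
    (φ : X → EReal) (x₀ v : X) : Prop :=
  ∃ c > 0, ∃ ε > 0, ∀ x ∈ Metric.ball x₀ ε,
    φ x₀ + ((inner ℝ v (x - x₀) + c / 2 * (Metric.infDist x {u | v ∈ subdiff φ u}) ^ 2 : ℝ) : EReal)
      ≤ φ x

/-- The Bouligand tangent (contingent) cone to `Ω` at `x₀`. -/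
def contingentCone {X : Type*} [NormedAddCommGroup X] [InnerProductSpace ℝ X]
    (Ω : Set X) (x₀ : X) : Set X :=
  {w | ∃ (t : ℕ → ℝ) (u : ℕ → X), (∀ k, 0 < t k) ∧ Tendsto t atTop (𝓝 0) ∧
    Tendsto u atTop (𝓝 w) ∧ ∀ k, x₀ + t k • u k ∈ Ω}

/-- A polyhedral set: the intersection of finitely many closed half-spaces. -/
def IsPolyhedralSet {X : Type*} [NormedAddCommGroup X] [InnerProductSpace ℝ X]
    (Ω : Set X) : Prop :=
  ∃ (n : ℕ) (a : Fin n → X) (β : Fin n → ℝ), Ω = {x | ∀ i, inner ℝ (a i) x ≤ β i}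

end ConvexAnalysis

section LeastSquares

/-- The objective `x ↦ (1/(2μ)) ‖Φ x - b‖² + g(K x)`. -/
noncomputable def lsObjective {X Y E : Type*}
    [NormedAddCommGroup X] [InnerProductSpace ℝ X]
    [NormedAddCommGroup Y] [InnerProductSpace ℝ Y]
    [NormedAddCommGroup E] [InnerProductSpace ℝ E]
    (Φ : X →ₗ[ℝ] E) (K : X →ₗ[ℝ] Y) (g : Y → EReal) (b : E) (μ : ℝ) (x : X) : EReal :=
  ((1 / (2 * μ) * ‖Φ x - b‖ ^ 2 : ℝ) : EReal) + g (K x)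

/-- The optimal solution mapping `(b, μ) ↦ argmin_x (1/(2μ)) ‖Φ x - b‖² + g(K x)`. -/
def lsArgmin {X Y E : Type*}
    [NormedAddCommGroup X] [InnerProductSpace ℝ X]
    [NormedAddCommGroup Y] [InnerProductSpace ℝ Y]
    [NormedAddCommGroup E] [InnerProductSpace ℝ E]
    (Φ : X →ₗ[ℝ] E) (K : X →ₗ[ℝ] Y) (g : Y → EReal) (b : E) (μ : ℝ) : Set X :=
  {x | ∀ u, lsObjective Φ K g b μ x ≤ lsObjective Φ K g b μ u}

/-- The solution mapping of the optimality system,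
`(b, μ) ↦ {x | 0 ∈ (1/μ) Φ*(Φ x - b) + K* ∂g(K x)}`. -/
noncomputable def lsStationary {X Y E : Type*}
    [NormedAddCommGroup X] [InnerProductSpace ℝ X] [FiniteDimensional ℝ X]
    [NormedAddCommGroup Y] [InnerProductSpace ℝ Y] [FiniteDimensional ℝ Y]
    [NormedAddCommGroup E] [InnerProductSpace ℝ E] [FiniteDimensional ℝ E]
    (Φ : X →ₗ[ℝ] E) (K : X →ₗ[ℝ] Y) (g : Y → EReal) (b : E) (μ : ℝ) : Set X :=
  {x | ∃ y ∈ subdiff g (K x),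
    (1 / μ) • LinearMap.adjoint Φ (Φ x - b) + LinearMap.adjoint K y = 0}

/-- Isolated calmness at `(b₀, μ₀)` for `x₀` of a set-valued mapping `S` of the two parameters
`b ∈ E` and `μ > 0`. -/
def IsolatedCalm {X E : Type*} [NormedAddCommGroup X] [NormedAddCommGroup E]
    (S : E → ℝ → Set X) (b₀ : E) (μ₀ : ℝ) (x₀ : X) : Prop :=
  x₀ ∈ S b₀ μ₀ ∧ ∃ κ > 0, ∃ U ∈ 𝓝 x₀, ∃ V ∈ 𝓝 b₀, ∃ W ∈ 𝓝 μ₀,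
    ∀ b ∈ V, ∀ μ ∈ W, 0 < μ → ∀ x ∈ S b μ ∩ U, ‖x - x₀‖ ≤ κ * (‖b - b₀‖ + |μ - μ₀|)

end LeastSquares

/-!
By Fenchel–Moreau, `∂g*(y₀)` is the set `C = (∂g)⁻¹(y₀)`
(`ProperLscConvex.subdiff_fenchelConj`), and by convexity both solution mappings contain the
stationary points and consist of minimizers.

Necessity (`IsolatedCalm.eq_zero_of_mem_contingentCone`): if `K (x₀ + t w) ∈ C`, then `x₀ + t w` is
stationary for the data `b₀ + t Φ w`, with the same multiplier `y₀`, because the residual is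
unchanged. Isolated calmness gives `‖w‖ ≤ κ ‖Φ w‖`, and in the limit a contingent direction in the
kernel of `Φ` must vanish.

Sufficiency (`isolatedCalm_lsArgmin`): for a minimizer `x` near `x₀`, comparing objective values at
`x` and `x₀` and using quadratic growth bounds `‖Φ (x - x₀)‖` and the distance from `K x` to `C` by a
multiple of the perturbation (`norm_sq_add_infDist_sq_le`). A compactness argument shows that the
kernel condition turns these two quantities into a bound for `‖x - x₀‖`
(`exists_norm_le_mul_add_infDist`).

The gap between the two kernel conditions is whether a contingent direction of `C` in the range of
`K` is one of `C ∩ range K`. For polyhedral `C` it is, as contingent directions are feasible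
(`IsPolyhedralSet.mem_contingentCone_inter`). If the range of `K` meets the relative interior of `C`
at `p`, the directions `v + τ (p - K x₀)` are feasible for `τ > 0`, and they converge to `v` as
`τ → 0` (`Convex.mem_contingentCone_inter`).
-/

section

variable {X Y E : Type*}
  [NormedAddCommGroup X] [InnerProductSpace ℝ X]
  [NormedAddCommGroup Y] [InnerProductSpace ℝ Y]
  [NormedAddCommGroup E] [InnerProductSpace ℝ E]

/-! ### Subgradients and the Fenchel conjugate -/

theorem ProperLscConvex.exists_real_of_mem_subdiff {φ : Y → EReal} (hφ : ProperLscConvex φ)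
    {z y : Y} (h : y ∈ subdiff φ z) : ∃ a : ℝ, φ z = a := by
  obtain ⟨w, hw⟩ := hφ.exists_ne_top
  have hz : φ z ≠ ⊤ := by
    intro hz
    have := h w
    rw [hz, EReal.top_add_coe, top_le_iff] at this
    exact hw this
  exact ⟨(φ z).toReal, (EReal.coe_toReal hz (hφ.ne_bot z)).symm⟩

theorem mem_subdiff_iff_of_eq_coe {φ : Y → EReal} {z y : Y} {a : ℝ} (ha : φ z = a) :
    y ∈ subdiff φ z ↔ ∀ (w : Y) (r : ℝ), φ w ≤ r → a + inner ℝ y (w - z) ≤ r := by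
  constructor
  · intro h w r hr
    have := (h w).trans hr
    rw [ha] at this
    exact_mod_cast this
  · intro h w
    rw [ha]
    refine EReal.le_of_forall_lt_iff_le.1 fun r hr => ?_
    exact_mod_cast h w r hr.le

theorem fenchelConj_le_coe_iff {φ : Y → EReal} {u : Y} {a : ℝ} :
    fenchelConj φ u ≤ a ↔ ∀ (w : Y) (r : ℝ), φ w ≤ r → inner ℝ u w - r ≤ a := by
  rw [fenchelConj, iSup_le_iff]
  constructor
  · intro h w r hr
    have := (EReal.sub_le_sub le_rfl hr).trans (h w)
    exact_mod_cast this
  · intro h w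
    rw [EReal.sub_le_iff_le_add (Or.inr (EReal.coe_ne_top _)) (Or.inr (EReal.coe_ne_bot _))]
    have : ((inner ℝ u w - a : ℝ) : EReal) ≤ φ w := by
      refine EReal.le_of_forall_lt_iff_le.1 fun r hr => ?_
      have := h w r hr.le
      exact_mod_cast (by linarith : inner ℝ u w - a ≤ r)
    calc ((inner ℝ u w : ℝ) : EReal) = (a : EReal) + ((inner ℝ u w - a : ℝ) : EReal) := by
          rw [← EReal.coe_add]; congr 1; ring
      _ ≤ a + φ w := by gcongr

theorem coe_sub_le_fenchelConj {φ : Y → EReal} {w : Y} {r : ℝ} (hr : φ w ≤ r) (u : Y) :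
    ((inner ℝ u w - r : ℝ) : EReal) ≤ fenchelConj φ u := by
  refine le_trans ?_ (le_iSup (fun x => ((inner ℝ u x : ℝ) : EReal) - φ x) w)
  rw [EReal.coe_sub]
  exact EReal.sub_le_sub le_rfl hr

/-- A pointwise form of the Fenchel–Moreau theorem: a point `z` at which the biconjugate is at most
`α` satisfies `φ z ≤ α`. It is enough that the conjugate is finite at one point `y`, which is used
to tilt a vertical separating hyperplane. -/
theorem ProperLscConvex.le_coe_of_forall_fenchelConj [FiniteDimensional ℝ Y]
    {φ : Y → EReal} (hφ : ProperLscConvex φ) {y z : Y} {α β : ℝ} (hy : fenchelConj φ y ≤ β)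
    (h : ∀ (u : Y) (b : ℝ), fenchelConj φ u ≤ b → inner ℝ z u - b ≤ α) : φ z ≤ α := by
  by_contra hlt
  have hclosed : IsClosed {p : Y × ℝ | φ p.1 ≤ (p.2 : EReal)} :=
    hφ.lsc.isClosed_epigraph.preimage
      (continuous_fst.prodMk (continuous_coe_real_ereal.comp continuous_snd))
  obtain ⟨f, c, hfc, hcf⟩ := geometric_hahn_banach_point_closed (x := (z, α)) hφ.convex hclosed hlt
  set v : Y := (InnerProductSpace.toDual ℝ Y).symm (f.comp (ContinuousLinearMap.inl ℝ Y ℝ)) with hv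
  set s : ℝ := f (0, 1) with hs
  have hf : ∀ w r, f (w, r) = inner ℝ v w + r * s := by
    intro w r
    have h1 : ((w, r) : Y × ℝ) = (w, 0) + r • (0, 1) := by simp
    rw [h1, map_add, map_smul, hv, InnerProductSpace.toDual_symm_apply]
    simp [hs]
  rw [hf] at hfc
  have hcf' : ∀ (w : Y) (r : ℝ), φ w ≤ r → c < inner ℝ v w + r * s := fun w r hr => by
    rw [← hf]; exact hcf (w, r) hr
  -- The epigraph is unbounded upwards, so the normal of the hyperplane points upwards.
  have hs0 : 0 ≤ s := by
    by_contra hneg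
    push Not at hneg
    obtain ⟨w, hw⟩ := hφ.exists_ne_top
    have ha := (EReal.coe_toReal hw (hφ.ne_bot w)).symm
    set a := (φ w).toReal
    have h1 := hcf' w (max a ((c - inner ℝ v w) / s))
      (by rw [ha]; exact_mod_cast le_max_left _ _)
    have h2 := mul_le_mul_of_nonpos_right (le_max_right a ((c - inner ℝ v w) / s)) hneg.le
    rw [div_mul_cancel₀ _ hneg.ne] at h2
    linarith
  rcases hs0.eq_or_lt with hs0 | hs0
  · -- Vertical hyperplane: move from `y` in the direction `-v`.
    rw [← hs0] at hfc hcf'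
    simp only [mul_zero, add_zero] at hfc hcf'
    set t : ℝ := (α - inner ℝ z y + β + 1) / (c - inner ℝ v z) with ht
    set t' : ℝ := max t 0
    have ht' : (α - inner ℝ z y + β + 1) ≤ t' * (c - inner ℝ v z) := by
      have := mul_le_mul_of_nonneg_right (le_max_left t 0) (sub_pos.2 hfc).le
      rwa [ht, div_mul_cancel₀ _ (sub_pos.2 hfc).ne'] at this
    have hconj : fenchelConj φ (y - t' • v) ≤ (β - t' * c : ℝ) := by
      rw [fenchelConj_le_coe_iff] at hy ⊢
      intro w r hr
      have h1 := hy w r hr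
      have h2 := mul_le_mul_of_nonneg_left (hcf' w r hr).le (le_max_right t 0)
      rw [inner_sub_left, real_inner_smul_left]
      linarith
    have := h _ _ hconj
    rw [inner_sub_right, real_inner_smul_right, real_inner_comm v z] at this
    linarith
  · have hconj : fenchelConj φ (-(s⁻¹ • v)) ≤ (-(s⁻¹ * c) : ℝ) := by
      rw [fenchelConj_le_coe_iff]
      intro w r hr
      have h1 := mul_le_mul_of_nonneg_left (hcf' w r hr).le (inv_pos.2 hs0).le
      rw [mul_add, mul_comm r s, inv_mul_cancel_left₀ hs0.ne'] at h1
      rw [inner_neg_left, real_inner_smul_left]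
      linarith
    have h1 := h _ _ hconj
    have h2 := mul_lt_mul_of_pos_left hfc (inv_pos.2 hs0)
    rw [mul_add, mul_comm α s, inv_mul_cancel_left₀ hs0.ne'] at h2
    rw [inner_neg_right, real_inner_smul_right, real_inner_comm v z] at h1
    linarith

/-- Inversion of the subdifferential: `∂φ*(y) = (∂φ)⁻¹(y)` for `y` in the range of `∂φ`. -/
theorem ProperLscConvex.subdiff_fenchelConj [FiniteDimensional ℝ Y]
    {φ : Y → EReal} (hφ : ProperLscConvex φ) {y z₀ : Y} (hy : y ∈ subdiff φ z₀) :
    subdiff (fenchelConj φ) y = {z | y ∈ subdiff φ z} := by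
  have key : ∀ z, y ∈ subdiff φ z → ∃ a : ℝ, φ z = a ∧
      fenchelConj φ y = ((inner ℝ y z - a : ℝ) : EReal) := by
    intro z hz
    obtain ⟨a, ha⟩ := hφ.exists_real_of_mem_subdiff hz
    refine ⟨a, ha, le_antisymm (fenchelConj_le_coe_iff.2 fun w r hr => ?_)
      (coe_sub_le_fenchelConj ha.le y)⟩
    have := (mem_subdiff_iff_of_eq_coe ha).1 hz w r hr
    rw [inner_sub_right] at this
    linarith
  ext z
  constructor
  · intro hz
    obtain ⟨a₀, -, hβ⟩ := key z₀ hy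
    set β : ℝ := inner ℝ y z₀ - a₀
    have hle : φ z ≤ (inner ℝ y z - β : ℝ) := by
      refine hφ.le_coe_of_forall_fenchelConj hβ.le fun u b hu => ?_
      have := (mem_subdiff_iff_of_eq_coe hβ).1 hz u b hu
      rw [inner_sub_right, real_inner_comm y z] at this
      linarith
    intro w
    refine EReal.le_of_forall_lt_iff_le.1 fun r hr => ?_
    have h1 := fenchelConj_le_coe_iff.1 hβ.le w r hr.le
    calc φ z + ((inner ℝ y (w - z) : ℝ) : EReal)
        ≤ ((inner ℝ y z - β : ℝ) : EReal) + ((inner ℝ y (w - z) : ℝ) : EReal) := by gcongr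
      _ ≤ r := by
        rw [inner_sub_right]
        exact_mod_cast (by linarith : inner ℝ y z - β + (inner ℝ y w - inner ℝ y z) ≤ r)
  · intro hz
    obtain ⟨a, ha, hβ⟩ := key z hz
    refine (mem_subdiff_iff_of_eq_coe hβ).2 fun u b hu => ?_
    have h1 : ((inner ℝ u z - a : ℝ) : EReal) ≤ b := (coe_sub_le_fenchelConj ha.le u).trans hu
    have h2 : inner ℝ u z - a ≤ b := by exact_mod_cast h1
    rw [inner_sub_right, real_inner_comm u z, real_inner_comm y z]
    linarith

theorem ProperLscConvex.convex_setOf_mem_subdiff {φ : Y → EReal} (hφ : ProperLscConvex φ) (y : Y) :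
    Convex ℝ {z | y ∈ subdiff φ z} := by
  intro z₁ hz₁ z₂ hz₂ s t hs ht hst
  obtain ⟨a₁, ha₁⟩ := hφ.exists_real_of_mem_subdiff hz₁
  obtain ⟨a₂, ha₂⟩ := hφ.exists_real_of_mem_subdiff hz₂
  have hle : φ (s • z₁ + t • z₂) ≤ ((s * a₁ + t * a₂ : ℝ) : EReal) :=
    hφ.convex (x := (z₁, a₁)) ha₁.le (y := (z₂, a₂)) ha₂.le hs ht hst
  intro w
  refine EReal.le_of_forall_lt_iff_le.1 fun r hr => ?_
  have h1 := (mem_subdiff_iff_of_eq_coe ha₁).1 hz₁ w r hr.le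
  have h2 := (mem_subdiff_iff_of_eq_coe ha₂).1 hz₂ w r hr.le
  have h3 : (s * a₁ + t * a₂) + inner ℝ y (w - (s • z₁ + t • z₂)) ≤ r := by
    have h4 : w - (s • z₁ + t • z₂) = s • (w - z₁) + t • (w - z₂) := by
      have : w = s • w + t • w := by rw [← add_smul, hst, one_smul]
      nth_rewrite 1 [this]
      module
    rw [h4, inner_add_right, real_inner_smul_right, real_inner_smul_right]
    calc _ = s * (a₁ + inner ℝ y (w - z₁)) + t * (a₂ + inner ℝ y (w - z₂)) := by ring
      _ ≤ s * r + t * r := by gcongr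
      _ = r := by rw [← add_mul, hst, one_mul]
  calc _ ≤ ((s * a₁ + t * a₂ : ℝ) : EReal)
        + ((inner ℝ y (w - (s • z₁ + t • z₂)) : ℝ) : EReal) := by gcongr
    _ ≤ r := by exact_mod_cast h3

/-! ### Contingent cones -/

theorem zero_mem_contingentCone {Ω : Set Y} {z : Y} (hz : z ∈ Ω) : 0 ∈ contingentCone Ω z :=
  ⟨fun k => 1 / ((k : ℝ) + 1), fun _ => 0, fun k => by positivity,
    tendsto_one_div_add_atTop_nhds_zero_nat, tendsto_const_nhds, fun k => by simpa using hz⟩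

/-- A polyhedral set contains a segment in each of its contingent directions, so intersecting with
a subspace does not lose contingent directions that lie in the subspace. -/
theorem IsPolyhedralSet.mem_contingentCone_inter {Ω : Set Y} (hΩ : IsPolyhedralSet Ω)
    (L : Submodule ℝ Y) {z v : Y} (hz : z ∈ Ω) (hzL : z ∈ L) (hvL : v ∈ L)
    (hv : v ∈ contingentCone Ω z) : v ∈ contingentCone (Ω ∩ L) z := by
  obtain ⟨n, a, β, rfl⟩ := hΩ
  obtain ⟨t, u, ht, -, hu, hmem⟩ := hv
  have hev : ∀ i, ∀ᶠ s : ℝ in 𝓝[>] 0, inner ℝ (a i) (z + s • v) ≤ β i := by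
    intro i
    rcases (hz i).eq_or_lt with heq | hlt
    · have hav : inner ℝ (a i) v ≤ 0 := by
        refine le_of_tendsto ((continuous_const.inner continuous_id).tendsto v |>.comp hu)
          (Eventually.of_forall fun k => ?_)
        have := hmem k i
        rw [inner_add_right, real_inner_smul_right, heq] at this
        have hle : t k * inner ℝ (a i) (u k) ≤ 0 := by linarith
        exact nonpos_of_mul_nonpos_right hle (ht k)
      filter_upwards [self_mem_nhdsWithin] with s hs
      rw [inner_add_right, real_inner_smul_right, heq]
      linarith [mul_nonpos_of_nonneg_of_nonpos (le_of_lt (mem_Ioi.1 hs)) hav]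
    · have hc : Continuous fun s : ℝ => inner ℝ (a i) (z + s • v) := by fun_prop
      have := (hc.tendsto 0).eventually_lt_const (u := β i) (by simpa using hlt)
      exact (this.filter_mono nhdsWithin_le_nhds).mono fun s hs => hs.le
  obtain ⟨δ, hδ, hsub⟩ := mem_nhdsGT_iff_exists_Ioo_subset.1 (eventually_all.2 hev)
  have hδ : 0 < δ := hδ
  have hfrac : ∀ k : ℕ, 1 / ((k : ℝ) + 1 + 1) < 1 := fun k => by
    rw [div_lt_one (by positivity)]
    linarith [(Nat.cast_nonneg k : (0 : ℝ) ≤ k)]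
  have hlim := (tendsto_one_div_add_atTop_nhds_zero_nat (𝕜 := ℝ)).comp (tendsto_add_atTop_nat 1)
  refine ⟨fun k => δ * (1 / ((k : ℝ) + 1 + 1)), fun _ => v, fun k => by positivity, ?_,
    tendsto_const_nhds, fun k => ⟨hsub ⟨by positivity, ?_⟩, L.add_mem hzL (L.smul_mem _ hvL)⟩⟩
  · simpa [Function.comp_def] using hlim.const_mul δ
  · exact mul_lt_of_lt_one_right hδ (hfrac k)

/-- If `v` is a contingent direction at `z` of a convex set and `p` is a relative interior point,
then all the tilted directions `v + τ (p - z)`, `τ > 0`, are feasible. -/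
theorem Convex.eventually_add_smul_mem_of_mem_contingentCone [FiniteDimensional ℝ Y] {Ω : Set Y}
    (hΩ : Convex ℝ Ω) {z p v : Y} (hz : z ∈ Ω) (hp : p ∈ intrinsicInterior ℝ Ω)
    (hv : v ∈ contingentCone Ω z) {τ : ℝ} (hτ : 0 < τ) :
    ∀ᶠ s : ℝ in 𝓝[>] 0, z + s • (v + τ • (p - z)) ∈ Ω := by
  obtain ⟨t, u, ht, -, hu, hmem⟩ := hv
  obtain ⟨p, hp, rfl⟩ := hp
  have hspan : ∀ {x}, x ∈ Ω → x ∈ affineSpan ℝ Ω := fun hx => subset_affineSpan ℝ Ω hx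
  have hudir : ∀ k, u k ∈ (affineSpan ℝ Ω).direction := by
    intro k
    have h1 := AffineSubspace.vsub_mem_direction (hspan (hmem k)) (hspan hz)
    have h2 := (affineSpan ℝ Ω).direction.smul_mem (t k)⁻¹ h1
    rwa [vsub_eq_sub, add_sub_cancel_left, inv_smul_smul₀ (ht k).ne'] at h2
  have hvdir : v ∈ (affineSpan ℝ Ω).direction :=
    (Submodule.closed_of_finiteDimensional (affineSpan ℝ Ω).direction).mem_of_tendsto hu
      (Eventually.of_forall hudir)
  let q : ℕ → affineSpan ℝ Ω := fun k => ⟨τ⁻¹ • (v - u k) +ᵥ (p : Y),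
    AffineSubspace.vadd_mem_of_mem_direction
      (Submodule.smul_mem _ _ (Submodule.sub_mem _ hvdir (hudir k))) p.2⟩
  have hq : Tendsto q atTop (𝓝 p) := by
    rw [tendsto_subtype_rng]
    have : Tendsto (fun k => τ⁻¹ • (v - u k) + (p : Y)) atTop (𝓝 (τ⁻¹ • (v - v) + (p : Y))) :=
      ((tendsto_const_nhds.sub hu).const_smul _).add tendsto_const_nhds
    simpa [q] using this
  obtain ⟨k, hk⟩ := (hq.eventually (mem_interior_iff_mem_nhds.1 hp)).exists
  have hqk : τ⁻¹ • (v - u k) + (p : Y) ∈ Ω := hk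
  have hpos : 0 < (t k)⁻¹ + τ := by have := ht k; positivity
  filter_upwards [Ioo_mem_nhdsGT (inv_pos.2 hpos)] with s hs
  have hs0 : 0 < s := hs.1
  have hs1 : s * ((t k)⁻¹ + τ) ≤ 1 := by
    have := mul_lt_mul_of_pos_right hs.2 hpos
    rw [inv_mul_cancel₀ hpos.ne'] at this
    exact this.le
  -- The tilted point is a convex combination of `z`, `z + t k • u k` and a point near `p`.
  have hcomb : z + s • (v + τ • ((p : Y) - z)) = (1 - s * ((t k)⁻¹ + τ)) • z
      + (s * (t k)⁻¹) • (z + t k • u k) + (s * τ) • (τ⁻¹ • (v - u k) + (p : Y)) := by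
    have h1 : (s * (t k)⁻¹) • (t k • u k) = s • u k := by
      rw [smul_smul, mul_assoc, inv_mul_cancel₀ (ht k).ne', mul_one]
    have h2 : (s * τ) • (τ⁻¹ • (v - u k)) = s • (v - u k) := by
      rw [smul_smul, mul_assoc, mul_inv_cancel₀ hτ.ne', mul_one]
    rw [smul_add (s * (t k)⁻¹), smul_add (s * τ), h1, h2]
    module
  rw [hcomb]
  have htk := ht k
  have h := hΩ.sum_mem (t := Finset.univ)
    (w := ![1 - s * ((t k)⁻¹ + τ), s * (t k)⁻¹, s * τ])
    (z := ![z, z + t k • u k, τ⁻¹ • (v - u k) + (p : Y)])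
    (by
      intro i _
      fin_cases i
      · simpa using hs1
      · simp; positivity
      · simp; positivity)
    (by simp [Fin.sum_univ_three]; ring)
    (by
      intro i _
      fin_cases i
      · simpa using hz
      · simpa using hmem k
      · simpa using hqk)
  simpa [Fin.sum_univ_three] using h

/-- If a subspace meets the relative interior of a convex set, contingent directions of the set
that lie in the subspace are contingent directions of the intersection. -/
theorem Convex.mem_contingentCone_inter [FiniteDimensional ℝ Y] {Ω : Set Y}
    (hΩ : Convex ℝ Ω) (L : Submodule ℝ Y) (hne : ((L : Set Y) ∩ intrinsicInterior ℝ Ω).Nonempty)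
    {z v : Y} (hz : z ∈ Ω) (hzL : z ∈ L) (hvL : v ∈ L)
    (hv : v ∈ contingentCone Ω z) : v ∈ contingentCone (Ω ∩ L) z := by
  obtain ⟨p, hpL, hp⟩ := hne
  have hpos : ∀ k : ℕ, 0 < 1 / ((k : ℝ) + 1) := fun k => by positivity
  have hex : ∀ k : ℕ, ∃ s : ℝ, (0 < s ∧ s < 1 / ((k : ℝ) + 1)) ∧
      z + s • (v + (1 / ((k : ℝ) + 1)) • (p - z)) ∈ Ω := fun k =>
    ((Filter.Eventually.and (Ioo_mem_nhdsGT (hpos k))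
      (hΩ.eventually_add_smul_mem_of_mem_contingentCone hz hp hv (hpos k)))).exists
  choose s hs hsmem using hex
  have hlim := tendsto_one_div_add_atTop_nhds_zero_nat (𝕜 := ℝ)
  refine ⟨s, fun k => v + (1 / ((k : ℝ) + 1)) • (p - z), fun k => (hs k).1,
    squeeze_zero (fun k => (hs k).1.le) (fun k => (hs k).2.le) hlim, ?_,
    fun k => ⟨hsmem k, L.add_mem hzL (L.smul_mem _ (L.add_mem hvL
      (L.smul_mem _ (L.sub_mem hpL hzL))))⟩⟩
  simpa using (hlim.smul_const (p - z)).const_add v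

/-- Sequences in the range of `K` that converge to `K w` lift to sequences converging to `w`. -/
theorem LinearMap.exists_tendsto_lift [FiniteDimensional ℝ Y] (K : X →ₗ[ℝ] Y)
    {u : ℕ → Y} {w : X} (hu : Tendsto u atTop (𝓝 (K w))) (hr : ∀ k, u k ∈ LinearMap.range K) :
    ∃ x : ℕ → X, (∀ k, K (x k) = u k) ∧ Tendsto x atTop (𝓝 w) := by
  obtain ⟨R, hR⟩ := K.rangeRestrict.exists_rightInverse_of_surjective K.range_rangeRestrict
  have hKR : ∀ y : LinearMap.range K, K (R y) = y := fun y =>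
    congrArg Subtype.val (LinearMap.congr_fun hR y)
  let d : ℕ → LinearMap.range K := fun k => ⟨u k, hr k⟩ - ⟨K w, LinearMap.mem_range_self K w⟩
  have hd : Tendsto d atTop (𝓝 0) := by
    rw [tendsto_subtype_rng]
    simpa [d] using hu.sub_const (K w)
  refine ⟨fun k => w + R (d k), fun k => ?_, ?_⟩
  · rw [map_add, hKR]
    simp [d]
  · have := ((LinearMap.continuous_of_finiteDimensional R).tendsto 0).comp hd
    simpa using this.const_add w

/-- If the kernel of `Φ` contains no nonzero vector that `K` maps to a contingent direction of `C`,
then small displacements `h` are controlled by `‖Φ h‖` and by the distance of `K x₀ + K h`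
to `C`. -/
theorem exists_norm_le_mul_add_infDist [FiniteDimensional ℝ X] (Φ : X →ₗ[ℝ] E)
    (K : X →ₗ[ℝ] Y) {C : Set Y} {x₀ : X}
    (hC : C.Nonempty)
    (hker : ∀ w, Φ w = 0 → K w ∈ contingentCone C (K x₀) → w = 0) :
    ∃ M > 0, ∃ δ > 0, ∀ x, ‖x - x₀‖ < δ →
      ‖x - x₀‖ ≤ M * (‖Φ (x - x₀)‖ + Metric.infDist (K x) C) := by
  by_contra hcon
  push Not at hcon
  have hpos : ∀ k : ℕ, 0 < (k : ℝ) + 1 := fun k => by positivity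
  have hex : ∀ k : ℕ, ∃ x, ‖x - x₀‖ < 1 / ((k : ℝ) + 1) ∧
      ((k : ℝ) + 1) * (‖Φ (x - x₀)‖ + Metric.infDist (K x) C) < ‖x - x₀‖ := fun k =>
    hcon _ (hpos k) _ (one_div_pos.2 (hpos k))
  choose x hxδ hxM using hex
  set t : ℕ → ℝ := fun k => ‖x k - x₀‖ with ht_def
  have ht : ∀ k, 0 < t k := fun k => lt_of_le_of_lt
    (mul_nonneg (hpos k).le (add_nonneg (norm_nonneg _) Metric.infDist_nonneg)) (hxM k)
  have hlim := tendsto_one_div_add_atTop_nhds_zero_nat (𝕜 := ℝ)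
  have ht0 : Tendsto t atTop (𝓝 0) :=
    squeeze_zero (fun k => (ht k).le) (fun k => (hxδ k).le) hlim
  have hM : ∀ k, ‖Φ (x k - x₀)‖ + Metric.infDist (K (x k)) C < t k * (1 / ((k : ℝ) + 1)) := by
    intro k
    rw [mul_one_div, lt_div_iff₀ (hpos k), mul_comm]
    exact hxM k
  have hdist : ∀ k, ∃ c ∈ C, dist (K (x k)) c < t k * (1 / ((k : ℝ) + 1)) := fun k =>
    (Metric.infDist_lt_iff hC).1 (lt_of_le_of_lt (le_add_of_nonneg_left (norm_nonneg _)) (hM k))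
  choose c hcC hcdist using hdist
  set d : ℕ → X := fun k => (t k)⁻¹ • (x k - x₀) with hd_def
  have hdnorm : ∀ k, ‖d k‖ = 1 := fun k => by
    rw [hd_def, norm_smul, norm_inv, Real.norm_of_nonneg (ht k).le, inv_mul_cancel₀ (ht k).ne']
  obtain ⟨w, hw, σ, hσ, hdw⟩ := (isCompact_sphere (0 : X) 1).tendsto_subseq
    (x := d) (fun k => by simpa using hdnorm k)
  have hlimσ := hlim.comp hσ.tendsto_atTop
  have hΦ : Tendsto (fun k => Φ (d k)) atTop (𝓝 0) := by
    refine squeeze_zero_norm (fun k => ?_) hlim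
    have h1 := (le_add_of_nonneg_right Metric.infDist_nonneg).trans (hM k).le
    rw [hd_def, map_smul, norm_smul, norm_inv, Real.norm_of_nonneg (ht k).le,
      inv_mul_le_iff₀ (ht k)]
    exact h1
  have hΦw : Φ w = 0 := tendsto_nhds_unique
    (((LinearMap.continuous_of_finiteDimensional Φ).tendsto w).comp hdw)
    (hΦ.comp hσ.tendsto_atTop)
  have hdiff : Tendsto (fun k => (t k)⁻¹ • (c k - K x₀) - K (d k)) atTop (𝓝 0) := by
    refine squeeze_zero_norm (fun k => ?_) hlim
    have h1 : (t k)⁻¹ • (c k - K x₀) - K (d k) = (t k)⁻¹ • (c k - K (x k)) := by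
      rw [hd_def, map_smul, map_sub]
      module
    rw [h1, norm_smul, norm_inv, Real.norm_of_nonneg (ht k).le, inv_mul_le_iff₀ (ht k),
      ← dist_eq_norm, dist_comm]
    exact (hcdist k).le
  have hw0 : w = 0 := by
    refine hker w hΦw ⟨t ∘ σ, fun k => (t (σ k))⁻¹ • (c (σ k) - K x₀), fun k => ht _,
      ht0.comp hσ.tendsto_atTop, ?_, fun k => ?_⟩
    · have h1 := (hdiff.comp hσ.tendsto_atTop).add
        (((LinearMap.continuous_of_finiteDimensional K).tendsto w).comp hdw)
      simpa [Function.comp_def] using h1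
    · rw [Function.comp_apply, smul_inv_smul₀ (ht _).ne', add_sub_cancel]
      exact hcC _
  rw [hw0] at hw
  simp at hw

/-! ### Solutions of the least squares problem -/

section LeastSquares

variable [FiniteDimensional ℝ X] [FiniteDimensional ℝ Y] [FiniteDimensional ℝ E]

theorem lsStationary_subset_lsArgmin (Φ : X →ₗ[ℝ] E) (K : X →ₗ[ℝ] Y) (g : Y → EReal) (b : E)
    {μ : ℝ} (hμ : 0 < μ) : lsStationary Φ K g b μ ⊆ lsArgmin Φ K g b μ := by
  rintro x ⟨y, hy, hxy⟩ u
  have h1 := hy (K u)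
  have h2 : inner ℝ y (K u - K x) = -(1 / μ * inner ℝ (Φ x - b) (Φ (u - x))) := by
    rw [← map_sub, ← LinearMap.adjoint_inner_left, eq_neg_of_add_eq_zero_right hxy,
      inner_neg_left, real_inner_smul_left, LinearMap.adjoint_inner_left]
  have h3 : 1 / (2 * μ) * ‖Φ x - b‖ ^ 2
      ≤ 1 / (2 * μ) * ‖Φ u - b‖ ^ 2 + inner ℝ y (K u - K x) := by
    have h4 : Φ u - b = (Φ x - b) + Φ (u - x) := by rw [map_sub]; abel
    rw [h2, h4, norm_add_sq_real]
    have h5 : 0 ≤ 1 / (2 * μ) * ‖Φ (u - x)‖ ^ 2 := by positivity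
    have h6 : 1 / μ = 2 * (1 / (2 * μ)) := by field_simp
    rw [h6]
    linarith
  calc lsObjective Φ K g b μ x
      ≤ ((1 / (2 * μ) * ‖Φ u - b‖ ^ 2 + inner ℝ y (K u - K x) : ℝ) : EReal) + g (K x) :=
        add_le_add (by exact_mod_cast h3) le_rfl
    _ = ((1 / (2 * μ) * ‖Φ u - b‖ ^ 2 : ℝ) : EReal)
          + (g (K x) + ((inner ℝ y (K u - K x) : ℝ) : EReal)) := by
        rw [EReal.coe_add, add_assoc, add_comm (g (K x))]
    _ ≤ lsObjective Φ K g b μ u := add_le_add le_rfl h1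

/-- Moving `x₀` along `w` inside `(∂g)⁻¹(y₀)` keeps it stationary if `b₀` is moved along `Φ w`,
since the residual does not change. Isolated calmness then bounds `‖w‖` by a multiple of `‖Φ w‖`,
which survives the passage to contingent directions. -/
theorem IsolatedCalm.eq_zero_of_mem_contingentCone {Φ : X →ₗ[ℝ] E} {K : X →ₗ[ℝ] Y} {g : Y → EReal}
    {S : E → ℝ → Set X} {b₀ : E} {μ₀ : ℝ} (hμ₀ : 0 < μ₀) {x₀ : X} {y₀ : Y}
    (hS : ∀ b, lsStationary Φ K g b μ₀ ⊆ S b μ₀)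
    (hKy₀ : LinearMap.adjoint K y₀ = -((1 / μ₀) • LinearMap.adjoint Φ (Φ x₀ - b₀)))
    (h : IsolatedCalm S b₀ μ₀ x₀) {w : X} (hΦw : Φ w = 0)
    (hw : K w ∈ contingentCone ({z | y₀ ∈ subdiff g z} ∩ (LinearMap.range K : Set Y)) (K x₀)) :
    w = 0 := by
  obtain ⟨-, κ, -, U, hU, V, hV, W, hW, hcalm⟩ := h
  obtain ⟨t, u, ht, ht0, hu, hmem⟩ := hw
  have hur : ∀ k, u k ∈ LinearMap.range K := by
    intro k
    have h1 : t k • u k ∈ LinearMap.range K := by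
      simpa using Submodule.sub_mem _ (hmem k).2 (LinearMap.mem_range_self K x₀)
    exact (Submodule.smul_mem_iff _ (ht k).ne').1 h1
  obtain ⟨x, hx, hxw⟩ := K.exists_tendsto_lift hu hur
  have hΦx : Tendsto (fun k => Φ (x k)) atTop (𝓝 0) := by
    have := ((LinearMap.continuous_of_finiteDimensional Φ).tendsto w).comp hxw
    rwa [hΦw] at this
  have hxlim : Tendsto (fun k => x₀ + t k • x k) atTop (𝓝 x₀) := by
    simpa using (ht0.smul hxw).const_add x₀
  have hblim : Tendsto (fun k => b₀ + t k • Φ (x k)) atTop (𝓝 b₀) := by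
    simpa using (ht0.smul hΦx).const_add b₀
  have hbound : ∀ᶠ k in atTop, ‖x k‖ ≤ κ * ‖Φ (x k)‖ := by
    filter_upwards [hxlim hU, hblim hV] with k hkU hkV
    have hst : x₀ + t k • x k ∈ lsStationary Φ K g (b₀ + t k • Φ (x k)) μ₀ := by
      refine ⟨y₀, ?_, ?_⟩
      · have := (hmem k).1
        rwa [← hx k, ← map_smul, ← map_add] at this
      · rw [hKy₀, map_add, map_smul, add_sub_add_right_eq_sub, add_neg_cancel]
    have h1 := hcalm _ hkV μ₀ (mem_of_mem_nhds hW) hμ₀ _ ⟨hS _ hst, hkU⟩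
    rw [add_sub_cancel_left, add_sub_cancel_left, sub_self, abs_zero, add_zero, norm_smul,
      norm_smul, Real.norm_of_nonneg (ht k).le, mul_left_comm] at h1
    exact le_of_mul_le_mul_left h1 (ht k)
  have h0 := le_of_tendsto_of_tendsto hxw.norm (hΦx.norm.const_mul κ) hbound
  rw [norm_zero, mul_zero] at h0
  exact norm_le_zero_iff.1 h0

/-- The basic estimate behind sufficiency: comparing the objective at a minimizer `x` with its value
at `x₀`, and bounding `g (K x)` from below by quadratic growth. No constraint qualification enters,
as optimality is only used through function values. -/
theorem norm_sq_add_infDist_sq_le {Φ : X →ₗ[ℝ] E} {K : X →ₗ[ℝ] Y} {g : Y → EReal}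
    {b₀ b : E} {μ₀ μ : ℝ} (hμ₀ : 0 < μ₀) (hμ : 0 < μ) {x₀ x : X} {y₀ : Y} {a q : ℝ}
    (hKy₀ : LinearMap.adjoint K y₀ = -((1 / μ₀) • LinearMap.adjoint Φ (Φ x₀ - b₀)))
    (ha : g (K x₀) = a) (hx : x ∈ lsArgmin Φ K g b μ)
    (hq : g (K x₀) + ((inner ℝ y₀ (K x - K x₀) + q : ℝ) : EReal) ≤ g (K x)) :
    ‖Φ (x - x₀)‖ ^ 2 + 2 * μ * q
      ≤ 2 * ((‖Φ x₀ - b₀‖ / μ₀ + 1) * (‖b - b₀‖ + |μ - μ₀|)) * ‖Φ (x - x₀)‖ := by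
  set r := Φ x₀ - b₀ with hr
  set p := Φ (x - x₀) with hp
  have h1 : 1 / (2 * μ) * ‖Φ x - b‖ ^ 2 + (a + (inner ℝ y₀ (K x - K x₀) + q))
      ≤ 1 / (2 * μ) * ‖Φ x₀ - b‖ ^ 2 + a := by
    have h := (add_le_add (le_refl ((1 / (2 * μ) * ‖Φ x - b‖ ^ 2 : ℝ) : EReal)) hq).trans (hx x₀)
    rw [lsObjective, ha] at h
    exact_mod_cast h
  have h2 : inner ℝ y₀ (K x - K x₀) = -(1 / μ₀ * inner ℝ r p) := by
    rw [← map_sub, ← LinearMap.adjoint_inner_left, hKy₀, inner_neg_left, real_inner_smul_left,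
      LinearMap.adjoint_inner_left]
  have h3 : Φ x - b = (r - (b - b₀)) + p := by rw [hr, hp, map_sub]; abel
  have h4 : Φ x₀ - b = r - (b - b₀) := by rw [hr]; abel
  rw [h2, h3, h4, norm_add_sq_real, inner_sub_left] at h1
  have h5 : ‖p‖ ^ 2 + 2 * μ * q ≤ 2 * ((μ - μ₀) / μ₀ * inner ℝ r p + inner ℝ (b - b₀) p) := by
    have h6 := mul_le_mul_of_nonneg_left h1 (by positivity : 0 ≤ 2 * μ)
    field_simp at h6 ⊢
    linarith
  have h7 : (μ - μ₀) / μ₀ * inner ℝ r p ≤ |μ - μ₀| / μ₀ * (‖r‖ * ‖p‖) := by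
    refine (le_abs_self _).trans ?_
    rw [abs_mul, abs_div, abs_of_pos hμ₀]
    gcongr
    exact abs_real_inner_le_norm r p
  have h8 : inner ℝ (b - b₀) p ≤ ‖b - b₀‖ * ‖p‖ := real_inner_le_norm _ _
  have h9 : 0 ≤ ‖r‖ / μ₀ * ‖b - b₀‖ * ‖p‖ + |μ - μ₀| * ‖p‖ := by positivity
  have h10 : |μ - μ₀| / μ₀ * (‖r‖ * ‖p‖) = ‖r‖ / μ₀ * |μ - μ₀| * ‖p‖ := by ring
  linarith

theorem isolatedCalm_lsArgmin {Φ : X →ₗ[ℝ] E} {K : X →ₗ[ℝ] Y} {g : Y → EReal}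
    (hg : ProperLscConvex g) {b₀ : E} {μ₀ : ℝ} (hμ₀ : 0 < μ₀) {x₀ : X} {y₀ : Y}
    (hx₀ : x₀ ∈ lsArgmin Φ K g b₀ μ₀) (hy₀ : y₀ ∈ subdiff g (K x₀))
    (hKy₀ : LinearMap.adjoint K y₀ = -((1 / μ₀) • LinearMap.adjoint Φ (Φ x₀ - b₀)))
    (hgrowth : QuadraticGrowth g (K x₀) y₀)
    (hker : ∀ w, Φ w = 0 → K w ∈ contingentCone {z | y₀ ∈ subdiff g z} (K x₀) → w = 0) :
    IsolatedCalm (lsArgmin Φ K g) b₀ μ₀ x₀ := by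
  obtain ⟨a, ha⟩ := hg.exists_real_of_mem_subdiff hy₀
  obtain ⟨c, hc, ε, hε, hgr⟩ := hgrowth
  set C : Set Y := {z | y₀ ∈ subdiff g z}
  obtain ⟨M, hM, δ, hδ, hbound⟩ := exists_norm_le_mul_add_infDist Φ K (C := C) ⟨K x₀, hy₀⟩ hker
  set L : ℝ := ‖Φ x₀ - b₀‖ / μ₀ + 1 with hL
  have hL0 : 0 < L := by positivity
  refine ⟨hx₀, M * (2 * L + Real.sqrt (8 / (μ₀ * c)) * L), by positivity,
    Metric.ball x₀ δ ∩ K ⁻¹' Metric.ball (K x₀) ε,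
    inter_mem (Metric.ball_mem_nhds x₀ hδ)
      ((LinearMap.continuous_of_finiteDimensional K).continuousAt (Metric.ball_mem_nhds _ hε)),
    univ, univ_mem, Ioi (μ₀ / 2), Ioi_mem_nhds (by linarith), ?_⟩
  rintro b - μ hμW hμ x ⟨hx, hxδ, hxε⟩
  have hμW : μ₀ / 2 < μ := hμW
  have hest := norm_sq_add_infDist_sq_le hμ₀ hμ hKy₀ ha hx (hgr (K x) hxε)
  have hb := hbound x (by rwa [← dist_eq_norm])
  rw [← hL] at hest
  set η := ‖b - b₀‖ + |μ - μ₀|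
  set D := Metric.infDist (K x) C
  set p := ‖Φ (x - x₀)‖
  have hη : 0 ≤ η := by positivity
  have hp : 0 ≤ p := norm_nonneg _
  have hD : 0 ≤ D := Metric.infDist_nonneg
  have hq0 : 0 ≤ 2 * μ * (c / 2 * D ^ 2) := by positivity
  have hLη : 0 ≤ L * η := by positivity
  have hp2 : p ≤ 2 * (L * η) := by
    by_contra hlt
    push Not at hlt
    have : 2 * (L * η) * p < p * p := mul_lt_mul_of_pos_right hlt (by linarith)
    nlinarith
  have hD2 : D ≤ Real.sqrt (8 / (μ₀ * c)) * (L * η) := by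
    refine (sq_le_sq₀ hD (by positivity)).1 ?_
    rw [mul_pow, Real.sq_sqrt (by positivity), div_mul_eq_mul_div, le_div_iff₀ (by positivity)]
    have h1 : 2 * (L * η) * p ≤ 2 * (L * η) * (2 * (L * η)) := by gcongr
    have h2 : μ₀ / 2 * (c * D ^ 2) ≤ μ * (c * D ^ 2) := by gcongr
    have h3 : 0 ≤ p ^ 2 := sq_nonneg p
    linarith
  calc ‖x - x₀‖ ≤ M * (p + D) := hb
    _ ≤ M * (2 * (L * η) + Real.sqrt (8 / (μ₀ * c)) * (L * η)) := by gcongr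
    _ = _ := by ring

end LeastSquares

end

/-! ### The characterization of isolated calmness -/

theorem theorem4p3 {X Y E : Type*}
    [NormedAddCommGroup X] [InnerProductSpace ℝ X] [FiniteDimensional ℝ X]
    [NormedAddCommGroup Y] [InnerProductSpace ℝ Y] [FiniteDimensional ℝ Y]
    [NormedAddCommGroup E] [InnerProductSpace ℝ E] [FiniteDimensional ℝ E]
    (Φ : X →ₗ[ℝ] E) (K : X →ₗ[ℝ] Y) (g : Y → EReal) (hg : ProperLscConvex g)
    (S : E → ℝ → Set X) (hS : S = lsArgmin Φ K g ∨ S = lsStationary Φ K g)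
    (b₀ : E) (μ₀ : ℝ) (hμ₀ : 0 < μ₀) (x₀ : X) (hx₀ : x₀ ∈ S b₀ μ₀)
    (y₀ : Y) (hy₀ : y₀ ∈ subdiff g (K x₀))
    (hKy₀ : LinearMap.adjoint K y₀ = -((1 / μ₀) • LinearMap.adjoint Φ (Φ x₀ - b₀))) :
    (IsolatedCalm S b₀ μ₀ x₀ →
      (LinearMap.ker Φ : Set X) ∩
        K ⁻¹' contingentCone (subdiff (fenchelConj g) y₀ ∩ (LinearMap.range K : Set Y)) (K x₀)
        = {0}) ∧
    (QuadraticGrowth g (K x₀) y₀ →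
      (LinearMap.ker Φ : Set X) ∩
        K ⁻¹' contingentCone (subdiff (fenchelConj g) y₀) (K x₀) = {0} →
      IsolatedCalm S b₀ μ₀ x₀) ∧
    (QuadraticGrowth g (K x₀) y₀ →
      (IsPolyhedralSet (subdiff (fenchelConj g) y₀) ∨
        ((LinearMap.range K : Set Y) ∩
          intrinsicInterior ℝ (subdiff (fenchelConj g) y₀)).Nonempty) →
      (IsolatedCalm S b₀ μ₀ x₀ ↔
        (LinearMap.ker Φ : Set X) ∩
          K ⁻¹' contingentCone (subdiff (fenchelConj g) y₀) (K x₀) = {0})) := by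
  have hx₀st : x₀ ∈ lsStationary Φ K g b₀ μ₀ := ⟨y₀, hy₀, by rw [hKy₀, add_neg_cancel]⟩
  have hsub := fun b μ (hμ : 0 < μ) => lsStationary_subset_lsArgmin Φ K g b hμ
  -- Either choice of `S` lies between the stationary points and the minimizers.
  have hSge : ∀ b, lsStationary Φ K g b μ₀ ⊆ S b μ₀ := by
    rcases hS with rfl | rfl
    · exact fun b => hsub b μ₀ hμ₀
    · exact fun b => Subset.rfl
  have hSle : ∀ b μ, 0 < μ → S b μ ⊆ lsArgmin Φ K g b μ := by
    rcases hS with rfl | rfl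
    · exact fun b μ _ => Subset.rfl
    · exact hsub
  rw [hg.subdiff_fenchelConj hy₀]
  have h0 : (0 : X) ∈ (LinearMap.ker Φ : Set X) := Submodule.zero_mem _
  have hsufficient : QuadraticGrowth g (K x₀) y₀ →
      (LinearMap.ker Φ : Set X) ∩ K ⁻¹' contingentCone {z | y₀ ∈ subdiff g z} (K x₀) = {0} →
      IsolatedCalm S b₀ μ₀ x₀ := by
    intro hgrowth hker
    obtain ⟨-, κ, hκ, U, hU, V, hV, W, hW, hcalm⟩ :=
      isolatedCalm_lsArgmin hg hμ₀ (hsub b₀ μ₀ hμ₀ hx₀st) hy₀ hKy₀ hgrowth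
        fun w hΦw hw => hker.subset ⟨hΦw, hw⟩
    exact ⟨hx₀, κ, hκ, U, hU, V, hV, W, hW, fun b hb μ hμW hμ x hx =>
      hcalm b hb μ hμW hμ x ⟨hSle b μ hμ hx.1, hx.2⟩⟩
  refine ⟨fun hcalm => ?_, hsufficient, fun hgrowth hcase => ⟨fun hcalm => ?_,
    hsufficient hgrowth⟩⟩
  · refine Subset.antisymm (fun w hw => hcalm.eq_zero_of_mem_contingentCone hμ₀ hSge hKy₀ hw.1 hw.2)
      (singleton_subset_iff.2 ⟨h0, ?_⟩)
    rw [mem_preimage, map_zero]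
    exact zero_mem_contingentCone ⟨hy₀, LinearMap.mem_range_self K x₀⟩
  · refine Subset.antisymm (fun w hw =>
      hcalm.eq_zero_of_mem_contingentCone hμ₀ hSge hKy₀ hw.1 ?_) (singleton_subset_iff.2 ⟨h0, ?_⟩)
    · have hzL := LinearMap.mem_range_self K x₀
      have hvL := LinearMap.mem_range_self K w
      rcases hcase with hpoly | hri
      · exact hpoly.mem_contingentCone_inter _ hy₀ hzL hvL hw.2
      · exact (hg.convex_setOf_mem_subdiff y₀).mem_contingentCone_inter _ hri hy₀ hzL hvL hw.2
    · rw [mem_preimage, map_zero]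
      exact zero_mem_contingentCone hy₀
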